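/- For $a\in\mathbb{C}$ and $n\in\mathbb{N}_0$ put $$c_n(a)=\frac1{2^n}\sum_{j=0}^{n}\binom nj\frac{(-1)^j}{(j+1)^a},\qquad f(s,a)=\frac{1-s}{\sum_{n=0}^{\infty}c_n(a)s^n},$$ and define the sequence $\hat b_0,\hat b_1,\ldots$ by $$\hat b_0=1,\quad \hat b_1=2^{-a-1}-2^{-1},\quad \hat b_n=c_{n-1}(a)-\sum_{l=0}^{n-1}\hat b_l\,c_{n-l}(a)\quad(n\ge 2).$$ Let $\hat\alpha_0(n)$, $n\in\mathbb{N}_0$, be the sequence given by $\hat\alpha_0(0)=1$ and $$\hat\alpha_0(n)=\frac1{\hat b_0}\Big(\hat\alpha_0(n-1)-\sum_{j=0}^{n-1}\hat b_{n-j}\,\hat\alpha_0(j)\Big),\qquad n\ge1 .$$ Let $\zeta$ be the Riemann zeta function, analytically continued to $\mathbb{C}\setminus\{1\}$. Suppose that $a\in\mathbb{C}$ is such that $f(s,a)$ is analytic in $|s|<1$ and $\lim_{s\to1^-}f(s,a)=0$. Then, with the sums of the series $\sum_j \hat b_j$ and $\sum_j j\hat b_j$ understood as $\lim_{s\to1^-}\sum_j\hat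 b_js^j$ and $\lim_{s\to1^-}\sum_j j\hat b_js^j$ (the power series converge for $|s|<1$ and both limits exist), $$\hat b_0+\hat b_1+\hat b_2+\cdots=1,\qquad \hat\alpha_0(n)=\sum_{k=0}^{n}\frac1{2^k}\sum_{j=0}^{k}\binom kj\frac{(-1)^j}{(j+1)^a}\quad(n\in\mathbb{N}_0),$$ $\sum_{j=1}^\infty j\hat b_j\neq1$, and, if $a\ne 1+\frac{2\pi i}{\log 2}n$ for all $n\in\mathbb{Z}$, then $2-2^{2-a}\neq 0$ and $$\zeta(a)=\frac1{2-2^{2-a}}\cdot\frac1{1-\sum_{j=1}^{\infty}j\,\hat b_j}.$$ If moreover $f(s,a)$ is analytic in the closed disc $|s|\le1$ (that is, at each of its points), then the series $\sum_j\hat b_j$ and $\sum_j j\hat b_j$ converge absolutely, and so have these sums in the ordinary sense. -/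

import Mathlib

noncomputable section

namespace RecurrentZeta

/-- `2⁻ⁿ ∑_{j=0}^{n} (n choose j) (-1)^j / (j+1)^a`. -/
def hasseTerm (a : ℂ) (n : ℕ) : ℂ :=
  1 / 2 ^ n * ∑ j ∈ Finset.range (n + 1), (n.choose j : ℂ) * ((-1) ^ j / ((j : ℂ) + 1) ^ a)

/-- The power series `∑ₙ 2⁻ⁿ ∑_{j=0}^{n} (n choose j) (-1)^j / (j+1)^a sⁿ`. -/
def hasseSeries (a s : ℂ) : ℂ := ∑' n : ℕ, hasseTerm a n * s ^ n

/-- `f(s, a)`, the quotient of `1 - s` by the power series above.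
At a zero `s ≠ 1` of the denominator Lean assigns the value `0`, but the quotient is unbounded
near such a point, so that it is not analytic there. -/
def f (s a : ℂ) : ℂ := (1 - s) / hasseSeries a s

/-- The sequence `b̂`. -/
def bHat (a : ℂ) : ℕ → ℂ
  | 0 => 1
  | 1 => 2 ^ (-a - 1) - 2⁻¹
  | n + 2 => hasseTerm a (n + 1) - ∑ l : Fin (n + 2), bHat a l * hasseTerm a (n + 2 - l)

/-- The sequence `α_k(n)`, `n = 0, 1, …`, attached to a sequence `b` and to integers `0 ≤ k < m`:
`α_k(n) = δ_{kn}` for `n < m`, and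
`α_k(n) = (α_k(n - m) - ∑_{j=0}^{n-1} b_{n-j} α_k(j)) / b_0` for `n ≥ m`.
(For `n = m` this gives `(1 - b_m) / b_0` if `k = 0` and `- b_{m-k} / b_0` if `k > 0`.
The meaningless case `m = 0` gets a default value.) -/
def alpha (b : ℕ → ℂ) (m k n : ℕ) : ℂ :=
  if n < m ∨ m = 0 then (if n = k then 1 else 0)
  else 1 / b 0 * (alpha b m k (n - m) - ∑ j : Fin n, b (n - j) * alpha b m k j)
termination_by n
decreasing_by
  · omega
  · exact j.isLt

/-- `u 0 + u 1 + u 2 + ⋯ = L` as a limit `s → 1⁻` of the power series `∑ u n sⁿ`, which has to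
converge in `|s| < 1`. -/
def HasAbelSum (u : ℕ → ℂ) (L : ℂ) : Prop :=
  (∀ s : ℂ, ‖s‖ < 1 → Summable fun n : ℕ => u n * s ^ n) ∧
    Filter.Tendsto (fun s : ℝ => ∑' n : ℕ, u n * (s : ℂ) ^ n) (nhdsWithin 1 (Set.Iio 1)) (nhds L)

end RecurrentZeta

end

open Filter Topology MeasureTheory

namespace RecurrentZeta

/-! Write C(s) = ∑ cₙ sⁿ, B(s) = ∑ b̂ₙ sⁿ. The recurrence for b̂ says B·C = 1 - s + s·C, that is,
B(s) = f(s, a) + s. The one for α̂₀ says A·B = 1 + s·A, whence A = C / (1 - s), and α̂₀ consists of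
the partial sums of the cₙ.

The binomial sums 2ⁿ cₙ grow polynomially in n, so C is holomorphic on |s| < 3/2. Analyticity of f
in the unit disc excludes zeros of C there, and f → 0 excludes a zero at 1. As s → 1⁻, B → 1 and
s·B' → f'(1) + 1 = 1 - 1 / C(1). Thus 1 / (1 - L) = C(1), which equals (2 - 2^(2-a)) ζ(a) by Hasse's
formula `hasseSeries_one`.

If f is analytic on the closed disc, C has no zero in a larger disc, and the two series converge at
s = 1 itself. -/

/-- The alternating binomial sums `∑ⱼ (n choose j) (-1)^j / (j+1)^a`. -/
noncomputable def altBinomSum (a : ℂ) (n : ℕ) : ℂ :=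
  ∑ j ∈ Finset.range (n + 1), (n.choose j : ℂ) * ((-1) ^ j / ((j : ℂ) + 1) ^ a)

lemma hasseTerm_eq (a : ℂ) (n : ℕ) : hasseTerm a n = 1 / 2 ^ n * altBinomSum a n := rfl

/-! ### Polynomial growth of the binomial sums -/

lemma integral_cpow_mul_exp_neg_nat (a : ℂ) (ha : 0 < a.re) (j : ℕ) :
    ∫ t in Set.Ioi (0 : ℝ), (t : ℂ) ^ (a - 1) * Complex.exp (-(((j + 1 : ℝ) : ℂ) * t)) =
      Complex.Gamma a / ((j : ℂ) + 1) ^ a := by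
  rw [Complex.integral_cpow_mul_exp_neg_mul_Ioi ha (by positivity), one_div, Complex.inv_cpow]
  · push_cast; rw [div_eq_inv_mul]
  · rw [Complex.arg_ofReal_of_nonneg (by positivity)]
    exact Real.pi_pos.ne

lemma integrableOn_cpow_mul_exp_neg_nat (a : ℂ) (ha : 0 < a.re) (j : ℕ) :
    IntegrableOn (fun t : ℝ => (t : ℂ) ^ (a - 1) * Complex.exp (-(((j + 1 : ℝ) : ℂ) * t)))
      (Set.Ioi 0) := by
  -- A non-integrable function has integral `0` by convention, whereas the known value is nonzero.
  by_contra h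
  have h1 := integral_cpow_mul_exp_neg_nat a ha j
  rw [integral_undef h] at h1
  refine div_ne_zero (Complex.Gamma_ne_zero_of_re_pos ha) ?_ h1.symm
  rw [Complex.cpow_def_of_ne_zero (Nat.cast_add_one_ne_zero j)]
  exact Complex.exp_ne_zero _

/-- Expand (1 - e⁻ᵗ)ⁿ by the binomial theorem. Since 0 ≤ 1 - e⁻ᵗ ≤ 1, this bounds the sums uniformly
in n when Re a > 0. -/
lemma Gamma_mul_altBinomSum (a : ℂ) (ha : 0 < a.re) (n : ℕ) :
    Complex.Gamma a * altBinomSum a n =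
      ∫ t in Set.Ioi (0 : ℝ), (t : ℂ) ^ (a - 1) * Complex.exp (-t) * (1 - Complex.exp (-t)) ^ n := by
  have h : ∀ t : ℝ, (t : ℂ) ^ (a - 1) * Complex.exp (-t) * (1 - Complex.exp (-t)) ^ n =
      ∑ j ∈ Finset.range (n + 1), ((n.choose j : ℂ) * (-1) ^ j) *
        ((t : ℂ) ^ (a - 1) * Complex.exp (-(((j + 1 : ℝ) : ℂ) * t))) := by
    intro t
    rw [sub_eq_neg_add (1 : ℂ), add_pow, Finset.mul_sum]
    refine Finset.sum_congr rfl fun j _ => ?_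
    have : Complex.exp (-(((j + 1 : ℝ) : ℂ) * t)) = Complex.exp (-t) * Complex.exp (-t) ^ j := by
      rw [← Complex.exp_nat_mul, ← Complex.exp_add]
      congr 1
      push_cast
      ring
    rw [this, neg_pow]
    ring
  simp_rw [h]
  rw [integral_finsetSum _ fun j _ => (integrableOn_cpow_mul_exp_neg_nat a ha j).const_mul _]
  rw [altBinomSum, Finset.mul_sum]
  refine Finset.sum_congr rfl fun j _ => ?_
  rw [integral_const_mul, integral_cpow_mul_exp_neg_nat a ha j]
  ring

lemma norm_altBinomSum_le_of_re_pos (a : ℂ) (ha : 0 < a.re) (n : ℕ) :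
    ‖altBinomSum a n‖ ≤ Real.Gamma a.re * ‖(Complex.Gamma a)⁻¹‖ := by
  have h0 : Complex.Gamma a ≠ 0 := Complex.Gamma_ne_zero_of_re_pos ha
  have h1 : ‖Complex.Gamma a * altBinomSum a n‖ ≤ Real.Gamma a.re := by
    rw [Gamma_mul_altBinomSum a ha, Real.Gamma_eq_integral ha]
    refine norm_integral_le_of_norm_le (Real.GammaIntegral_convergent ha) ?_
    filter_upwards [ae_restrict_mem measurableSet_Ioi] with t ht
    have ht : 0 < t := ht
    have h2 : ‖(1 - Complex.exp (-t)) ^ n‖ ≤ 1 := by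
      rw [norm_pow]
      refine pow_le_one₀ (norm_nonneg _) ?_
      rw [← Complex.ofReal_neg, ← Complex.ofReal_exp, ← Complex.ofReal_one, ← Complex.ofReal_sub,
        Complex.norm_real, Real.norm_eq_abs, abs_le]
      have := Real.exp_pos (-t)
      have := Real.exp_le_one_iff.2 (neg_nonpos.2 ht.le)
      constructor <;> linarith
    rw [norm_mul, norm_mul, Complex.norm_cpow_eq_rpow_re_of_pos ht, Complex.norm_exp]
    simp only [Complex.sub_re, Complex.one_re, Complex.neg_re, Complex.ofReal_re]
    rw [mul_comm (Real.exp _)]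
    exact mul_le_of_le_one_right (by positivity) h2
  rw [norm_mul] at h1
  rw [norm_inv, ← div_eq_mul_inv, le_div_iff₀ (norm_pos_iff.2 h0), mul_comm]
  exact h1

@[simp]
lemma altBinomSum_zero (a : ℂ) : altBinomSum a 0 = 1 := by simp [altBinomSum]

/-- Termwise, (n+1)·C(n,j) = (n+1-j)·C(n+1,j), and (n+2) - (n+1-j) = j+1 cancels one power of j+1.
Each shift of a to a + 1 costs a factor linear in n, which extends the bound to all a. -/
lemma altBinomSum_succ_eq (a : ℂ) (n : ℕ) :
    altBinomSum a (n + 1) =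
      (n + 2) * altBinomSum (a + 1) (n + 1) - (n + 1) * altBinomSum (a + 1) n := by
  have h : altBinomSum (a + 1) n = ∑ j ∈ Finset.range (n + 1 + 1),
      (n.choose j : ℂ) * ((-1) ^ j / ((j : ℂ) + 1) ^ (a + 1)) := by
    rw [Finset.sum_range_succ, altBinomSum]
    simp
  rw [h, altBinomSum, altBinomSum, Finset.mul_sum, Finset.mul_sum, ← Finset.sum_sub_distrib]
  refine Finset.sum_congr rfl fun j hj => ?_
  have hj : j ≤ n + 1 := by simpa [Nat.lt_succ_iff] using hj
  have hc : (n.choose j : ℂ) * (n + 1) = ((n + 1).choose j) * (n + 1 - j) := by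
    have := Nat.choose_mul_succ_eq n j
    have h2 : ((n.choose j * (n + 1) : ℕ) : ℂ) = (((n + 1).choose j * (n + 1 - j) : ℕ) : ℂ) := by
      rw [this]
    push_cast [Nat.cast_sub hj] at h2
    exact h2
  have hj0 : (j : ℂ) + 1 ≠ 0 := Nat.cast_add_one_ne_zero j
  have hp : ((j : ℂ) + 1) ^ a ≠ 0 := by
    rw [Complex.cpow_def_of_ne_zero hj0]
    exact Complex.exp_ne_zero _
  rw [Complex.cpow_add _ _ hj0, Complex.cpow_one]
  field_simp
  linear_combination (1 : ℂ) * hc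

lemma norm_altBinomSum_le (m : ℕ) : ∀ (a : ℂ), -(m : ℝ) < a.re → ∀ n : ℕ, ‖altBinomSum a n‖ ≤
    (2 * n + 1) ^ m * (Real.Gamma (a + m).re * ‖(Complex.Gamma (a + m))⁻¹‖) := by
  induction m with
  | zero =>
    intro a ha n
    simpa using norm_altBinomSum_le_of_re_pos a (by simpa using ha) n
  | succ m ih =>
    intro a ha n
    have ha1 : -(m : ℝ) < (a + 1).re := by
      simp only [Complex.add_re, Complex.one_re]
      push_cast at ha
      linarith
    have he : a + ((m + 1 : ℕ) : ℂ) = a + 1 + m := by push_cast; ring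
    rw [he]
    specialize ih (a + 1) ha1
    set M := Real.Gamma (a + 1 + m).re * ‖(Complex.Gamma (a + 1 + m))⁻¹‖
    cases n with
    | zero => simpa using ih 0
    | succ n =>
      have h1 := ih (n + 1)
      have hM : 0 ≤ M := by simpa using (norm_nonneg _).trans (ih 0)
      have h2 : ‖altBinomSum (a + 1) n‖ ≤ (2 * (n + 1 : ℕ) + 1) ^ m * M := by
        refine (ih n).trans ?_
        gcongr
        simp
      rw [altBinomSum_succ_eq]
      calc _ ≤ ‖((n : ℂ) + 2) * altBinomSum (a + 1) (n + 1)‖ +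
            ‖((n : ℂ) + 1) * altBinomSum (a + 1) n‖ := norm_sub_le _ _
        _ = ((n : ℝ) + 2) * ‖altBinomSum (a + 1) (n + 1)‖ +
            ((n : ℝ) + 1) * ‖altBinomSum (a + 1) n‖ := by
          rw [norm_mul, norm_mul]
          congr 2
          · exact_mod_cast Complex.norm_natCast (n + 2)
          · exact_mod_cast Complex.norm_natCast (n + 1)
        _ ≤ ((n : ℝ) + 2) * ((2 * (n + 1 : ℕ) + 1) ^ m * M) +
            ((n : ℝ) + 1) * ((2 * (n + 1 : ℕ) + 1) ^ m * M) := by gcongr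
        _ = _ := by push_cast; ring

/-- Uniformity in a near a₀ is what makes C(1) holomorphic in a. -/
lemma exists_norm_altBinomSum_le (a₀ : ℂ) : ∃ (m : ℕ) (K : ℝ), ∀ a ∈ Metric.ball a₀ 1, ∀ n : ℕ,
    ‖altBinomSum a n‖ ≤ (2 * n + 1) ^ m * K := by
  obtain ⟨m, hm⟩ := exists_nat_gt (1 - a₀.re)
  have hre : ∀ a ∈ Metric.closedBall a₀ 1, -(m : ℝ) < a.re := by
    intro a ha
    have h1 : |(a - a₀).re| ≤ 1 :=
      (Complex.abs_re_le_norm _).trans (by simpa [dist_eq_norm] using ha)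
    have := (abs_le.1 h1).1
    simp only [Complex.sub_re] at this
    linarith
  have hc : ContinuousOn (fun a : ℂ => Real.Gamma (a + m).re * ‖(Complex.Gamma (a + m))⁻¹‖)
      (Metric.closedBall a₀ 1) := by
    intro a ha
    refine (ContinuousAt.mul ?_ ?_).continuousWithinAt
    · have hp : 0 < (a + m).re := by simpa using by linarith [hre a ha]
      have : ContinuousAt Real.Gamma (a + m).re :=
        (Real.differentiableOn_Gamma_Ioi.differentiableAt (Ioi_mem_nhds hp)).continuousAt
      exact this.comp (f := fun a : ℂ => (a + m).re) (by fun_prop)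
    · exact (Complex.differentiable_one_div_Gamma.continuous.comp
        (continuous_add_const _)).norm.continuousAt
  obtain ⟨K, hK⟩ := (isCompact_closedBall a₀ 1).exists_bound_of_continuousOn hc
  refine ⟨m, K, fun a ha n => ?_⟩
  have ha := Metric.ball_subset_closedBall ha
  refine (norm_altBinomSum_le m a (hre a ha) n).trans ?_
  gcongr
  exact (le_abs_self _).trans (hK a ha)

/-! ### Holomorphy of the Hasse series in s and in a -/

lemma summable_pow_mul_geometric (m : ℕ) (K : ℝ) :
    -- The ratio 3/4 is (3/2)/2: radius 3/2 against the factor 2⁻ⁿ.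
    Summable fun n : ℕ => (2 * (n : ℝ) + 1) ^ m * K * (3 / 4) ^ n := by
  have h := (summable_pow_mul_geometric_of_norm_lt_one m (r := (3 / 4 : ℝ))
    (by norm_num [abs_of_pos])).mul_left (3 ^ m * |K|)
  refine Summable.of_norm_bounded_eventually_nat h ?_
  filter_upwards [eventually_ge_atTop 1] with n hn
  have hn : (1 : ℝ) ≤ n := by exact_mod_cast hn
  rw [norm_mul, norm_mul, Real.norm_eq_abs K, Real.norm_of_nonneg (by positivity),
    Real.norm_of_nonneg (by positivity)]
  have : (2 * (n : ℝ) + 1) ^ m ≤ (3 * n) ^ m := by gcongr; linarith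
  calc _ ≤ (3 * (n : ℝ)) ^ m * |K| * (3 / 4) ^ n := by gcongr
    _ = _ := by rw [mul_pow]; ring

lemma norm_hasseTerm_mul_pow_le {a s : ℂ} {m n : ℕ} {K : ℝ}
    (h : ‖altBinomSum a n‖ ≤ (2 * n + 1) ^ m * K) (hs : ‖s‖ ≤ 3 / 2) :
    ‖hasseTerm a n * s ^ n‖ ≤ (2 * (n : ℝ) + 1) ^ m * K * (3 / 4) ^ n := by
  have hK := (norm_nonneg _).trans h
  have : ‖hasseTerm a n * s ^ n‖ = ‖altBinomSum a n‖ * (‖s‖ / 2) ^ n := by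
    rw [hasseTerm_eq, norm_mul, norm_mul, norm_div, norm_pow, norm_pow, norm_one, div_pow]
    simp only [RCLike.norm_ofNat]
    ring
  rw [this]
  have hs' : ‖s‖ / 2 ≤ 3 / 4 := by linarith
  gcongr

lemma summable_norm_hasseTerm (a : ℂ) {s : ℂ} (hs : ‖s‖ ≤ 3 / 2) :
    Summable fun n => ‖hasseTerm a n * s ^ n‖ := by
  obtain ⟨m, K, h⟩ := exists_norm_altBinomSum_le a
  exact Summable.of_nonneg_of_le (fun _ => norm_nonneg _)
    (fun n => norm_hasseTerm_mul_pow_le (h a (Metric.mem_ball_self one_pos) n) hs)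
    (summable_pow_mul_geometric m K)

lemma differentiableOn_hasseSeries (a : ℂ) :
    DifferentiableOn ℂ (hasseSeries a) (Metric.ball 0 (3 / 2)) := by
  obtain ⟨m, K, h⟩ := exists_norm_altBinomSum_le a
  exact Complex.differentiableOn_tsum_of_summable_norm (summable_pow_mul_geometric m K)
    (fun n => by fun_prop) Metric.isOpen_ball
    fun n s hs => norm_hasseTerm_mul_pow_le (h a (Metric.mem_ball_self one_pos) n)
      (by simpa using (mem_ball_zero_iff.1 hs).le)

lemma differentiable_hasseTerm (n : ℕ) : Differentiable ℂ fun a => hasseTerm a n := by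
  unfold hasseTerm
  refine Differentiable.const_mul (Differentiable.fun_sum fun j _ => ?_) _
  refine Differentiable.const_mul (Differentiable.div (differentiable_const _) ?_ ?_) _
  · exact fun a => differentiableAt_id.const_cpow (Or.inl (Nat.cast_add_one_ne_zero j))
  · intro a
    rw [Complex.cpow_def_of_ne_zero (Nat.cast_add_one_ne_zero j)]
    exact Complex.exp_ne_zero _

lemma differentiable_hasseSeries_one : Differentiable ℂ fun a => hasseSeries a 1 := by
  intro a₀
  obtain ⟨m, K, h⟩ := exists_norm_altBinomSum_le a₀
  refine (Complex.differentiableOn_tsum_of_summable_norm (summable_pow_mul_geometric m K)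
    (F := fun n a => hasseTerm a n * 1 ^ n) (U := Metric.ball a₀ 1)
    (fun n => ((differentiable_hasseTerm n).mul_const _).differentiableOn) Metric.isOpen_ball
    fun n a ha => norm_hasseTerm_mul_pow_le (h a ha n) (by norm_num)).differentiableAt
    (Metric.ball_mem_nhds a₀ one_pos)

@[simp]
lemma hasseTerm_zero (a : ℂ) : hasseTerm a 0 = 1 := by simp [hasseTerm_eq]

lemma hasseSeries_zero (a : ℂ) : hasseSeries a 0 = 1 := by
  rw [hasseSeries, tsum_eq_single 0 fun n hn => by simp [hn]]
  simp

/-! ### Hasse's formula for zeta -/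

lemma hasSum_choose_mul_half_pow (j : ℕ) :
    HasSum (fun n : ℕ => (n.choose j : ℝ) * (1 / 2) ^ n) 2 := by
  have h := (hasSum_choose_mul_geometric_of_norm_lt_one j (r := (1 / 2 : ℝ))
    (by norm_num)).mul_right ((1 / 2) ^ j)
  have h2 : HasSum (fun n : ℕ => ((n + j).choose j : ℝ) * (1 / 2) ^ (n + j)) 2 := by
    convert! h using 1
    · ext n
      rw [pow_add, mul_assoc]
    · rw [show (1 : ℝ) - 1 / 2 = 1 / 2 by norm_num, pow_succ]
      field_simp
  rw [hasSum_nat_add_iff (f := fun n : ℕ => (n.choose j : ℝ) * (1 / 2) ^ n) j] at h2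
  rwa [Finset.sum_eq_zero fun n hn => by
    simp [Nat.choose_eq_zero_of_lt (Finset.mem_range.1 hn)], add_zero] at h2

lemma hasSum_choose_mul_half_pow_complex (j : ℕ) :
    HasSum (fun n : ℕ => (n.choose j : ℂ) * (1 / 2) ^ n) 2 := by
  simpa using Complex.hasSum_ofReal.2 (hasSum_choose_mul_half_pow j)

/-- Interchange the double sum: each xⱼ receives the weight ∑ₙ C(n,j) 2⁻ⁿ = 2. -/
lemma tsum_half_pow_mul_binomial_sum {x : ℕ → ℂ} (hx : Summable fun j => ‖x j‖) :
    ∑' n : ℕ, 1 / 2 ^ n * ∑ j ∈ Finset.range (n + 1), (n.choose j : ℂ) * x j = 2 * ∑' j, x j := by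
  have hs : Summable (Function.uncurry fun j n : ℕ => (n.choose j : ℂ) * (1 / 2) ^ n * x j) := by
    refine Summable.of_norm ?_
    have hn : ∀ j n : ℕ, ‖(n.choose j : ℂ) * (1 / 2) ^ n * x j‖ =
        (n.choose j : ℝ) * (1 / 2) ^ n * ‖x j‖ := by
      intro j n
      simp
    have ht : ∀ j, HasSum (fun n : ℕ => ‖(n.choose j : ℂ) * (1 / 2) ^ n * x j‖) (2 * ‖x j‖) := by
      intro j
      simp_rw [hn]
      exact (hasSum_choose_mul_half_pow j).mul_right _
    refine (summable_prod_of_nonneg fun _ => norm_nonneg _).2 ⟨fun j => (ht j).summable, ?_⟩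
    simpa only [Function.uncurry_apply_pair, (ht _).tsum_eq] using hx.mul_left 2
  have h1 : ∀ n : ℕ, 1 / 2 ^ n * ∑ j ∈ Finset.range (n + 1), (n.choose j : ℂ) * x j =
      ∑' j, (n.choose j : ℂ) * (1 / 2) ^ n * x j := by
    intro n
    rw [tsum_eq_sum (s := Finset.range (n + 1)), Finset.mul_sum]
    · refine Finset.sum_congr rfl fun j _ => ?_
      rw [one_div_pow]
      ring
    · intro j hj
      simp [Nat.choose_eq_zero_of_lt (show n < j by simpa using hj)]
  simp_rw [h1]
  rw [hs.tsum_comm, ← tsum_mul_left]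
  exact tsum_congr fun j => ((hasSum_choose_mul_half_pow_complex j).mul_right _).tsum_eq

lemma tsum_neg_one_pow_mul {y : ℕ → ℂ} (hy : Summable y) :
    ∑' j, (-1) ^ j * y j = ∑' j, y j - 2 * ∑' k, y (2 * k + 1) := by
  have hx : Summable fun j : ℕ => (-1) ^ j * y j :=
    Summable.of_norm (by simpa using hy.norm)
  have i0 : Function.Injective fun k : ℕ => 2 * k :=
    fun x y h => by dsimp only at h; omega
  have i1 : Function.Injective fun k : ℕ => 2 * k + 1 :=
    fun x y h => by dsimp only at h; omega
  have hy0 : Summable fun k => y (2 * k) := hy.comp_injective i0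
  have hy1 : Summable fun k => y (2 * k + 1) := hy.comp_injective i1
  have hx0 : Summable fun k => (-1) ^ (2 * k) * y (2 * k) := hx.comp_injective i0
  have hx1 : Summable fun k => (-1) ^ (2 * k + 1) * y (2 * k + 1) := hx.comp_injective i1
  rw [← tsum_even_add_odd hy0 hy1,
    ← tsum_even_add_odd (f := fun j => (-1) ^ j * y j) hx0 hx1]
  have e : ∀ k, (-1) ^ (2 * k + 1) * y (2 * k + 1) = -y (2 * k + 1) := fun k => by
    rw [pow_succ, pow_mul, neg_one_sq, one_pow, one_mul, neg_one_mul]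
  simp only [e, tsum_neg, pow_mul, neg_one_sq, one_pow, one_mul]
  ring

lemma tsum_one_div_even_cpow {a : ℂ} (ha : 1 < a.re) :
    ∑' k : ℕ, 1 / (((2 * k + 1 : ℕ) : ℂ) + 1) ^ a = 2 ^ (-a) * riemannZeta a := by
  rw [zeta_eq_tsum_one_div_nat_add_one_cpow ha, ← tsum_mul_left]
  refine tsum_congr fun k => ?_
  have : (((2 * k + 1 : ℕ) : ℂ) + 1) = ((2 : ℕ) : ℂ) * ((k + 1 : ℕ) : ℂ) := by push_cast; ring
  rw [this, Complex.natCast_mul_natCast_cpow, Complex.cpow_neg]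
  push_cast
  rw [one_div, mul_inv, one_div]

lemma tsum_neg_one_pow_div_cpow {a : ℂ} (ha : 1 < a.re) :
    ∑' j : ℕ, (-1) ^ j / ((j : ℂ) + 1) ^ a = (1 - 2 * 2 ^ (-a)) * riemannZeta a := by
  have hy : Summable fun j : ℕ => 1 / ((j : ℂ) + 1) ^ a := by
    simpa using (summable_nat_add_iff 1).2 (Complex.summable_one_div_nat_cpow.2 ha)
  have h := tsum_neg_one_pow_mul hy
  rw [tsum_one_div_even_cpow ha, ← zeta_eq_tsum_one_div_nat_add_one_cpow ha] at h
  simp only [mul_one_div] at h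
  rw [h]
  ring

lemma two_cpow_two_sub (a : ℂ) : (2 : ℂ) ^ (2 - a) = 4 * 2 ^ (-a) := by
  rw [sub_eq_add_neg, Complex.cpow_add _ _ two_ne_zero]
  norm_num

lemma hasseSeries_one_of_one_lt_re {a : ℂ} (ha : 1 < a.re) :
    hasseSeries a 1 = (2 - 2 ^ (2 - a)) * riemannZeta a := by
  have hx : Summable fun j : ℕ => ‖(-1) ^ j / ((j : ℂ) + 1) ^ a‖ := by
    have : Summable fun j : ℕ => 1 / ((j : ℂ) + 1) ^ a := by
      simpa using (summable_nat_add_iff 1).2 (Complex.summable_one_div_nat_cpow.2 ha)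
    simpa using this.norm
  have h := tsum_half_pow_mul_binomial_sum hx
  rw [tsum_neg_one_pow_div_cpow ha] at h
  simp only [hasseSeries, hasseTerm, one_pow, mul_one]
  rw [h, two_cpow_two_sub]
  ring

/-- Hasse's series for the Riemann zeta function. -/
theorem hasseSeries_one {a : ℂ} (ha : a ≠ 1) :
    hasseSeries a 1 = (2 - 2 ^ (2 - a)) * riemannZeta a := by
  have h1 : AnalyticOnNhd ℂ (fun a => hasseSeries a 1) {1}ᶜ :=
    differentiable_hasseSeries_one.differentiableOn.analyticOnNhd isOpen_compl_singleton
  have h2 : AnalyticOnNhd ℂ (fun a : ℂ => (2 - 2 ^ (2 - a)) * riemannZeta a) {1}ᶜ := by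
    refine DifferentiableOn.analyticOnNhd ?_ isOpen_compl_singleton
    refine DifferentiableOn.mul (Differentiable.differentiableOn ?_) differentiableOn_riemannZeta
    refine (differentiable_const _).sub fun a => ?_
    exact ((differentiableAt_const _).sub differentiableAt_id).const_cpow (Or.inl two_ne_zero)
  -- Identity theorem on the connected set ℂ ∖ {1}, starting from the half-plane Re a > 1 around 2.
  refine h1.eqOn_of_preconnected_of_eventuallyEq h2
    (isConnected_compl_singleton_of_one_lt_rank (by simp) 1).isPreconnected
    (z₀ := 2) (by norm_num) ?_ ha
  have : {a : ℂ | 1 < a.re} ∈ 𝓝 (2 : ℂ) :=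
    (isOpen_lt continuous_const Complex.continuous_re).mem_nhds (by norm_num)
  filter_upwards [this] with a ha using hasseSeries_one_of_one_lt_re ha

lemma two_sub_two_cpow_ne_zero {a : ℂ}
    (ha : ∀ n : ℤ, a ≠ 1 + 2 * (Real.pi : ℂ) * Complex.I / (Real.log 2 : ℂ) * (n : ℂ)) :
    (2 : ℂ) - 2 ^ (2 - a) ≠ 0 := by
  intro h
  have hlog : (Real.log 2 : ℂ) ≠ 0 := by exact_mod_cast (Real.log_pos one_lt_two).ne'
  have h2 : (2 : ℂ) ^ (2 - a) = 2 ^ (1 : ℂ) := by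
    rw [Complex.cpow_one]
    linear_combination -h
  have hl : Complex.log 2 = (Real.log 2 : ℂ) := by
    rw [Complex.ofReal_log zero_le_two, Complex.ofReal_ofNat]
  rw [Complex.cpow_def_of_ne_zero two_ne_zero, Complex.cpow_def_of_ne_zero two_ne_zero,
    Complex.exp_eq_exp_iff_exists_int, hl] at h2
  obtain ⟨n, hn⟩ := h2
  refine ha (-n) ?_
  push_cast
  field_simp
  linear_combination -hn

/-! ### The recurrences as identities of formal power series -/

lemma hasseTerm_one (a : ℂ) : hasseTerm a 1 = 1 / 2 * (1 - 2 ^ (-a)) := by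
  rw [hasseTerm, Finset.sum_range_succ, Finset.sum_range_one, Complex.cpow_neg]
  norm_num
  ring

open PowerSeries in
lemma mk_bHat_mul_mk_hasseTerm (a : ℂ) :
    mk (bHat a) * mk (hasseTerm a) = 1 - X + X * mk (hasseTerm a) := by
  ext n
  rw [coeff_mul, Finset.Nat.sum_antidiagonal_eq_sum_range_succ
    (fun i j => coeff i (mk (bHat a)) * coeff j (mk (hasseTerm a)))]
  simp only [coeff_mk, map_add, map_sub]
  match n with
  | 0 => simp [bHat]
  | 1 =>
    rw [coeff_one, coeff_one_X, coeff_succ_X_mul 0]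
    simp only [Finset.sum_range_succ, Finset.sum_range_zero, bHat, hasseTerm_zero, hasseTerm_one,
      coeff_mk, Nat.sub_zero, Nat.sub_self]
    rw [sub_eq_add_neg (-a), Complex.cpow_add _ _ two_ne_zero, Complex.cpow_neg_one]
    norm_num
    ring
  | n + 2 =>
    rw [coeff_one, coeff_X, coeff_succ_X_mul, Finset.sum_range_succ]
    simp only [coeff_mk, bHat, Nat.sub_self, hasseTerm_zero]
    rw [Fin.sum_univ_eq_sum_range (fun l => bHat a l * hasseTerm a (n + 2 - l))]
    simp

open PowerSeries in
lemma mk_bHat_mul_mk_partialSum (a : ℂ) :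
    mk (bHat a) * mk (fun n => ∑ k ∈ Finset.range (n + 1), hasseTerm a k) =
      1 + X * mk (fun n => ∑ k ∈ Finset.range (n + 1), hasseTerm a k) := by
  set A : ℂ⟦X⟧ := mk (fun n => ∑ k ∈ Finset.range (n + 1), hasseTerm a k) with hA
  -- Multiplication by 1 - X takes differences of the partial sums.
  have h1 : A * (1 - X) = mk (hasseTerm a) := by
    ext n
    rw [mul_sub, mul_one, map_sub]
    cases n with
    | zero => simp [hA]
    | succ n =>
      rw [coeff_succ_mul_X, hA, coeff_mk, coeff_mk, coeff_mk, Finset.sum_range_succ _ (n + 1)]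
      ring
  have h2 : (1 - X : ℂ⟦X⟧) ≠ 0 := by
    intro h
    simpa using congrArg (coeff 0) h
  refine mul_right_cancel₀ h2 ?_
  rw [mul_assoc, h1, mk_bHat_mul_mk_hasseTerm, ← h1]
  ring

open PowerSeries in
lemma alpha_bHat (a : ℂ) (n : ℕ) :
    alpha (bHat a) 1 0 n = ∑ k ∈ Finset.range (n + 1), hasseTerm a k := by
  induction n using Nat.strong_induction_on with
  | _ n ih =>
    rw [alpha]
    cases n with
    | zero => simp
    | succ n =>
      have h := congrArg (coeff (n + 1)) (mk_bHat_mul_mk_partialSum a)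
      rw [mul_comm, coeff_mul, Finset.Nat.sum_antidiagonal_eq_sum_range_succ
        (fun i j => coeff i (mk fun n => ∑ k ∈ Finset.range (n + 1), hasseTerm a k) *
          coeff j (mk (bHat a))), map_add, coeff_succ_X_mul, coeff_one, Finset.sum_range_succ] at h
      simp only [coeff_mk, Nat.succ_ne_zero, if_false, zero_add, Nat.sub_self, bHat, mul_one] at h
      have h3 : ∑ j : Fin (n + 1), bHat a (n + 1 - j) * alpha (bHat a) 1 0 j =
          ∑ j ∈ Finset.range (n + 1), (∑ k ∈ Finset.range (j + 1), hasseTerm a k) *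
            bHat a (n + 1 - j) := by
        rw [← Fin.sum_univ_eq_sum_range (fun j => (∑ k ∈ Finset.range (j + 1), hasseTerm a k) *
            bHat a (n + 1 - j))]
        exact Finset.sum_congr rfl fun j _ => by rw [ih j j.isLt, mul_comm]
      rw [if_neg (by omega), h3, Nat.add_sub_cancel, ih n (Nat.lt_succ_self n), ← h]
      simp [bHat]

/-! ### Taylor expansion of f -/

lemma eq_of_hasSum_mul_pow {u v : ℕ → ℂ} {h : ℂ → ℂ} {R : ℝ} (hR : 0 < R)
    (hu : ∀ s : ℂ, ‖s‖ < R → HasSum (fun n => u n * s ^ n) (h s))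
    (hv : ∀ s : ℂ, ‖s‖ < R → HasSum (fun n => v n * s ^ n) (h s)) : u = v := by
  have key : ∀ w : ℕ → ℂ, (∀ s : ℂ, ‖s‖ < R → HasSum (fun n => w n * s ^ n) (h s)) →
      HasFPowerSeriesAt h (FormalMultilinearSeries.ofScalars ℂ w) 0 := by
    intro w hw
    rw [hasFPowerSeriesAt_iff]
    filter_upwards [Metric.ball_mem_nhds (0 : ℂ) hR] with s hs
    simpa [mul_comm] using hw s (by simpa using hs)
  have := (key u hu).eq_formalMultilinearSeries (key v hv)
  ext n
  simpa using congrArg (fun p => p.coeff n) this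

lemma hasSum_taylor {g : ℂ → ℂ} {R : ℝ} (hg : DifferentiableOn ℂ g (Metric.ball 0 R)) {s : ℂ}
    (hs : ‖s‖ < R) :
    HasSum (fun n : ℕ => iteratedDeriv n g 0 / n.factorial * s ^ n) (g s) := by
  have h := Complex.hasSum_taylorSeries_on_ball hg (z := s) (by simpa using hs)
  convert! h using 2 with n
  simp only [smul_eq_mul, sub_zero]
  ring

lemma hasSum_nat_mul_taylor {g : ℂ → ℂ} {R : ℝ} (hg : DifferentiableOn ℂ g (Metric.ball 0 R))
    {s : ℂ} (hs : ‖s‖ < R) :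
    HasSum (fun n : ℕ => n * (iteratedDeriv n g 0 / n.factorial) * s ^ n) (s * deriv g s) := by
  have h := (hasSum_taylor (hg.deriv Metric.isOpen_ball) hs).mul_left s
  rw [← hasSum_nat_add_iff' 1]
  simp only [Finset.range_one, Finset.sum_singleton, Nat.cast_zero, zero_mul, sub_zero]
  convert! h using 2 with n
  rw [← iteratedDeriv_succ', Nat.factorial_succ, pow_succ]
  have := Nat.cast_add_one_ne_zero (R := ℂ) n
  have h2 : (n.factorial : ℂ) ≠ 0 := by exact_mod_cast n.factorial_ne_zero
  push_cast
  field_simp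

lemma differentiableOn_f {a : ℂ} {R : ℝ} (hR : R ≤ 3 / 2)
    (hC : ∀ s : ℂ, ‖s‖ < R → hasseSeries a s ≠ 0) :
    DifferentiableOn ℂ (fun s => f s a) (Metric.ball 0 R) := by
  refine DifferentiableOn.div (by fun_prop)
    ((differentiableOn_hasseSeries a).mono (Metric.ball_subset_ball hR)) fun s hs => ?_
  exact hC s (by simpa using hs)

-- The Taylor series of f times C is 1 - X, and cancelling C in B·C = 1 - X + X·C leaves f + X; the
-- correction at n = 1 is this X.
open PowerSeries in
lemma bHat_eq_taylor {a : ℂ} {R : ℝ} (hR0 : 0 < R) (hR : R ≤ 3 / 2)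
    (hC : ∀ s : ℂ, ‖s‖ < R → hasseSeries a s ≠ 0) (n : ℕ) :
    bHat a n = iteratedDeriv n (fun s => f s a) 0 / n.factorial + if n = 1 then 1 else 0 := by
  set γ : ℕ → ℂ := fun n => iteratedDeriv n (fun s => f s a) 0 / n.factorial with hγ
  have hg := differentiableOn_f hR hC
  have h1 : (fun n => ∑ k ∈ Finset.range (n + 1), γ k * hasseTerm a (n - k)) =
      fun n => coeff n (1 - X : ℂ⟦X⟧) := by
    refine eq_of_hasSum_mul_pow (h := fun s => 1 - s) hR0 (fun s hs => ?_) fun s hs => ?_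
    · have hs1 := hasSum_taylor hg hs
      have h := hasSum_sum_range_mul_of_summable_norm hs1.summable.norm
        (summable_norm_hasseTerm a (hs.le.trans hR))
      rw [hs1.tsum_eq] at h
      change HasSum _ ((1 - s) / hasseSeries a s * hasseSeries a s) at h
      rw [div_mul_cancel₀ _ (hC s hs)] at h
      convert! h using 2 with n
      rw [Finset.sum_mul]
      refine Finset.sum_congr rfl fun k hk => ?_
      have hk : k ≤ n := by simpa [Nat.lt_succ_iff] using hk
      rw [← Nat.add_sub_of_le hk, pow_add, Nat.add_sub_cancel_left]
      ring
    · have := hasSum_sum_of_ne_finset_zero (L := .unconditional ℕ) (s := Finset.range 2)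
        (f := fun n => coeff n (1 - X : ℂ⟦X⟧) * s ^ n) fun n hn => by
          simp only [Finset.mem_range, not_lt] at hn
          rw [map_sub, coeff_one, coeff_X, if_neg (by omega), if_neg (by omega)]
          simp
      convert! this using 1
      simp [Finset.sum_range_succ, coeff_one, coeff_X, sub_eq_add_neg]
  have h2 : mk γ * mk (hasseTerm a) = 1 - X := by
    ext n
    rw [coeff_mul, Finset.Nat.sum_antidiagonal_eq_sum_range_succ
      (fun i j => coeff i (mk γ) * coeff j (mk (hasseTerm a)))]
    simpa using congrFun h1 n
  have h3 : mk (hasseTerm a) ≠ 0 := by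
    intro h
    simpa using congrArg (coeff 0) h
  have h4 : mk (bHat a) = mk γ + X := by
    refine mul_right_cancel₀ h3 ?_
    rw [mk_bHat_mul_mk_hasseTerm, add_mul, h2]
  simpa [coeff_X] using congrArg (coeff n) h4

lemma hasSum_bHat {a : ℂ} {R : ℝ} (hR : R ≤ 3 / 2)
    (hC : ∀ s : ℂ, ‖s‖ < R → hasseSeries a s ≠ 0) {s : ℂ} (hs : ‖s‖ < R) :
    HasSum (fun n => bHat a n * s ^ n) (f s a + s) := by
  have h := (hasSum_taylor (differentiableOn_f hR hC) hs).add (hasSum_ite_eq 1 s)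
  convert! h using 2 with n
  rw [bHat_eq_taylor ((norm_nonneg s).trans_lt hs) hR hC, add_mul]
  congr 1
  split_ifs with h <;> simp [h]

lemma hasSum_nat_mul_bHat {a : ℂ} {R : ℝ} (hR : R ≤ 3 / 2)
    (hC : ∀ s : ℂ, ‖s‖ < R → hasseSeries a s ≠ 0) {s : ℂ} (hs : ‖s‖ < R) :
    HasSum (fun n : ℕ => n * bHat a n * s ^ n) (s * deriv (fun s => f s a) s + s) := by
  have h := (hasSum_nat_mul_taylor (differentiableOn_f hR hC) hs).add (hasSum_ite_eq 1 s)
  convert! h using 2 with n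
  rw [bHat_eq_taylor ((norm_nonneg s).trans_lt hs) hR hC, mul_add, add_mul]
  congr 1
  split_ifs with h <;> simp [h]

/-! ### Zeros of the denominator and behaviour at 1 -/

/-- `f(·, a)` is not analytic at a zero `s ≠ 1` of its denominator. -/
lemma hasseSeries_ne_zero_of_analyticAt {a s : ℂ} (hs : ‖s‖ < 3 / 2) (hs1 : s ≠ 1)
    (hf : AnalyticAt ℂ (fun s => f s a) s) : hasseSeries a s ≠ 0 := by
  intro h0
  have hC : AnalyticOnNhd ℂ (hasseSeries a) (Metric.ball 0 (3 / 2)) :=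
    (differentiableOn_hasseSeries a).analyticOnNhd Metric.isOpen_ball
  have hsb : s ∈ Metric.ball (0 : ℂ) (3 / 2) := by simpa using hs
  rcases (hC s hsb).eventually_eq_zero_or_eventually_ne_zero with h | h
  · have := hC.eqOn_zero_of_preconnected_of_eventuallyEq_zero
      (convex_ball (0 : ℂ) (3 / 2)).isPreconnected hsb h (x := 0) (by simp)
    rw [hasseSeries_zero] at this
    exact one_ne_zero this
  -- f·C is continuous at s and equals 1 - z at nearby z ≠ s, which forces 0 = 1 - s.
  · have h1 : Tendsto (fun z => f z a * hasseSeries a z) (𝓝[≠] s) (𝓝 (f s a * hasseSeries a s)) :=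
      (hf.continuousAt.mul (hC s hsb).continuousAt).tendsto.mono_left nhdsWithin_le_nhds
    have h2 : Tendsto (fun z => f z a * hasseSeries a z) (𝓝[≠] s) (𝓝 (1 - s)) := by
      have h3 : Tendsto (fun z : ℂ => 1 - z) (𝓝[≠] s) (𝓝 (1 - s)) :=
        (continuous_const.sub continuous_id).continuousAt.tendsto.mono_left nhdsWithin_le_nhds
      refine h3.congr' ?_
      filter_upwards [h] with z hz
      rw [f, div_mul_cancel₀ _ hz]
    have h4 := tendsto_nhds_unique h1 h2
    rw [h0, mul_zero] at h4
    exact hs1 (sub_eq_zero.1 h4.symm).symm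

lemma tendsto_ofReal_nhdsLT_one : Tendsto (fun s : ℝ => (s : ℂ)) (𝓝[<] 1) (𝓝 1) := by
  have := (Complex.continuous_ofReal.tendsto 1).mono_left (nhdsWithin_le_nhds (s := Set.Iio 1))
  simpa using this

lemma eventually_norm_lt_one : ∀ᶠ s : ℝ in 𝓝[<] 1, ‖(s : ℂ)‖ < 1 := by
  filter_upwards [Ioo_mem_nhdsLT (show (0 : ℝ) < 1 by norm_num)] with s hs
  rw [Complex.norm_real, Real.norm_of_nonneg hs.1.le]
  exact hs.2

lemma differentiableAt_hasseSeries_one (a : ℂ) : DifferentiableAt ℂ (hasseSeries a) 1 :=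
  (differentiableOn_hasseSeries a).differentiableAt
    (Metric.isOpen_ball.mem_nhds (by simp; norm_num))

/-- If C(1) = 0, then f times the difference quotient of C at 1 is identically -1, yet it tends to
0·C'(1). -/
lemma hasseSeries_one_ne_zero {a : ℂ} (hC : ∀ s : ℂ, ‖s‖ < 1 → hasseSeries a s ≠ 0)
    (hlim : Tendsto (fun s : ℝ => f (s : ℂ) a) (𝓝[<] 1) (𝓝 0)) : hasseSeries a 1 ≠ 0 := by
  intro h0
  have hne : Tendsto (fun s : ℝ => (s : ℂ)) (𝓝[<] 1) (𝓝[≠] 1) := by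
    refine tendsto_nhdsWithin_iff.2 ⟨tendsto_ofReal_nhdsLT_one, ?_⟩
    filter_upwards [self_mem_nhdsWithin] with s hs
    have : s ≠ 1 := ne_of_lt hs
    simpa using this
  have h1 := (differentiableAt_hasseSeries_one a).hasDerivAt.tendsto_slope.comp hne
  have h2 := hlim.mul h1
  rw [zero_mul] at h2
  have h3 : Tendsto (fun _ : ℝ => (-1 : ℂ)) (𝓝[<] 1) (𝓝 0) := by
    refine h2.congr' ?_
    filter_upwards [eventually_norm_lt_one, self_mem_nhdsWithin] with s hs hs1
    have hs1 : (s : ℂ) - 1 ≠ 0 := by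
      rw [sub_ne_zero]
      exact_mod_cast ne_of_lt hs1
    have := hC s hs
    simp only [Function.comp_apply, slope_def_field, h0, sub_zero, f]
    field_simp
    ring
  simpa using tendsto_nhds_unique h3 tendsto_const_nhds

lemma hasDerivAt_f_one {a : ℂ} (h : hasseSeries a 1 ≠ 0) :
    HasDerivAt (fun s => f s a) (-(1 / hasseSeries a 1)) 1 := by
  have := ((hasDerivAt_id (1 : ℂ)).const_sub 1).div (differentiableAt_hasseSeries_one a).hasDerivAt h
  convert! this using 1
  simp only [id]
  field_simp
  ring

lemma tendsto_deriv_f {a : ℂ} (h : hasseSeries a 1 ≠ 0) :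
    Tendsto (deriv fun s => f s a) (𝓝 1) (𝓝 (-(1 / hasseSeries a 1))) := by
  have hC : AnalyticAt ℂ (hasseSeries a) 1 :=
    (differentiableOn_hasseSeries a).analyticAt (Metric.isOpen_ball.mem_nhds (by simp; norm_num))
  have hf : AnalyticAt ℂ (fun s => f s a) 1 := (analyticAt_const.sub analyticAt_id).div hC h
  rw [← (hasDerivAt_f_one h).deriv]
  exact hf.deriv.continuousAt

/-- Compactness of the closed disc gives a radius R > 1, so that s = 1 becomes an interior point. -/
lemma exists_ball_hasseSeries_ne_zero {a : ℂ}
    (hC : ∀ s : ℂ, ‖s‖ ≤ 1 → hasseSeries a s ≠ 0) :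
    ∃ R : ℝ, 1 < R ∧ R ≤ 3 / 2 ∧ ∀ s : ℂ, ‖s‖ < R → hasseSeries a s ≠ 0 := by
  have ho : IsOpen (Metric.ball (0 : ℂ) (3 / 2) ∩ hasseSeries a ⁻¹' {0}ᶜ) :=
    (differentiableOn_hasseSeries a).continuousOn.isOpen_inter_preimage Metric.isOpen_ball
      isOpen_compl_singleton
  obtain ⟨δ, hδ, h⟩ := (isCompact_closedBall (0 : ℂ) 1).exists_thickening_subset_open ho
    fun s hs => by
      have hs : ‖s‖ ≤ 1 := by simpa using hs
      exact ⟨by simpa using hs.trans_lt (by norm_num), hC s hs⟩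
  rw [thickening_closedBall hδ zero_le_one] at h
  refine ⟨min (δ + 1) (3 / 2), lt_min (by linarith) (by norm_num), min_le_right _ _, fun s hs => ?_⟩
  exact (h (mem_ball_zero_iff.2 (hs.trans_le (min_le_left _ _)))).2

end RecurrentZeta

theorem proposition3 (a : ℂ)
    (hf : AnalyticOnNhd ℂ (fun s : ℂ => RecurrentZeta.f s a) (Metric.ball 0 1))
    (hlim : Filter.Tendsto (fun s : ℝ => RecurrentZeta.f (s : ℂ) a)
      (nhdsWithin 1 (Set.Iio 1)) (nhds 0)) :
    RecurrentZeta.HasAbelSum (RecurrentZeta.bHat a) 1 ∧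
    (∀ n : ℕ, RecurrentZeta.alpha (RecurrentZeta.bHat a) 1 0 n =
      ∑ k ∈ Finset.range (n + 1), 1 / 2 ^ k *
        ∑ j ∈ Finset.range (k + 1), (k.choose j : ℂ) * ((-1) ^ j / ((j : ℂ) + 1) ^ a)) ∧
    ∃ L : ℂ,
      RecurrentZeta.HasAbelSum (fun j : ℕ => (j : ℂ) * RecurrentZeta.bHat a j) L ∧
      1 - L ≠ 0 ∧
      ((∀ n : ℤ, a ≠ 1 + 2 * (Real.pi : ℂ) * Complex.I / (Real.log 2 : ℂ) * (n : ℂ)) →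
        (2 : ℂ) - 2 ^ (2 - a) ≠ 0 ∧
        riemannZeta a = 1 / (2 - 2 ^ (2 - a)) * (1 / (1 - L))) ∧
      (AnalyticOnNhd ℂ (fun s : ℂ => RecurrentZeta.f s a) (Metric.closedBall 0 1) →
        HasSum (RecurrentZeta.bHat a) 1 ∧
        HasSum (fun j : ℕ => (j : ℂ) * RecurrentZeta.bHat a j) L) := by
  open RecurrentZeta in
  have hC : ∀ s : ℂ, ‖s‖ < 1 → hasseSeries a s ≠ 0 := fun s hs =>
    hasseSeries_ne_zero_of_analyticAt (hs.trans (by norm_num))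
      (fun h => by simp [h] at hs) (hf s (by simpa using hs))
  have hC1 := hasseSeries_one_ne_zero hC hlim
  refine ⟨⟨fun s hs => (hasSum_bHat (by norm_num) hC hs).summable, ?_⟩, alpha_bHat a,
    1 - 1 / hasseSeries a 1,
    ⟨fun s hs => (hasSum_nat_mul_bHat (by norm_num) hC hs).summable, ?_⟩, ?_, fun ha => ?_,
    fun hcl => ?_⟩
  · have h := hlim.add tendsto_ofReal_nhdsLT_one
    rw [zero_add] at h
    refine h.congr' ?_
    filter_upwards [eventually_norm_lt_one] with s hs
    exact (hasSum_bHat (by norm_num) hC hs).tsum_eq.symm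
  · have h := (tendsto_ofReal_nhdsLT_one.mul
      ((tendsto_deriv_f hC1).comp tendsto_ofReal_nhdsLT_one)).add tendsto_ofReal_nhdsLT_one
    rw [show (1 : ℂ) - 1 / hasseSeries a 1 = 1 * -(1 / hasseSeries a 1) + 1 by ring]
    refine h.congr' ?_
    filter_upwards [eventually_norm_lt_one] with s hs
    exact (hasSum_nat_mul_bHat (by norm_num) hC hs).tsum_eq.symm
  · rw [sub_sub_cancel]
    exact one_div_ne_zero hC1
  · have h2 := two_sub_two_cpow_ne_zero ha
    refine ⟨h2, ?_⟩
    -- The case n = 0 of the hypothesis excludes the pole a = 1.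
    rw [sub_sub_cancel, one_div_one_div, hasseSeries_one (by simpa using ha 0)]
    field_simp
  · obtain ⟨R, hR1, hR, hCR⟩ := exists_ball_hasseSeries_ne_zero (a := a) fun s hs => by
      -- At s = 1 the numerator vanishes too, so analyticity of f alone would not exclude a zero of
      -- C; the limit hypothesis does.
      rcases eq_or_ne s 1 with rfl | hs1
      · exact hC1
      · exact hasseSeries_ne_zero_of_analyticAt (hs.trans_lt (by norm_num)) hs1
          (hcl s (by simpa using hs))
    have h1 : ‖(1 : ℂ)‖ < R := by simpa using hR1
    constructor
    · simpa [f] using hasSum_bHat hR hCR h1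
    · have h := hasSum_nat_mul_bHat hR hCR h1
      rw [(hasDerivAt_f_one hC1).deriv] at h
      convert! h using 1
      · simp
      · ring
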